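/- **Separation theorem for pseudoconvex sets.** Let $S$ be a finite linearly ordered set. A family $\mathcal F$ of subsets of $S$ is *ABA-free* if there are no $A,B\in\mathcal F$ and $x<y<z$ in $S$ with $x,z\in A\setminus B$ and $y\in B\setminus A$; write $\bar{\mathcal F}=\{S\setminus X: X\in\mathcal F\}$. A *pseudohalfplane hypergraph* on $S$ is a family $\mathcal H$ of subsets of $S$ (hyperedges) together with an ABA-free family $\mathcal F$ on $S$ such that $\mathcal H\subseteq\mathcal F\cup\bar{\mathcal F}$; its *topsets* are the members of $\mathcal H\cap\mathcal F$ and its *bottomsets* are the members of $\mathcal H\cap\bar{\mathcal F}$. For a set $X$ of vertices, $\mathrm{Conv}(X)$ is the intersection of all hyperedges containing $X$ (the whole vertex set if there is none). An *extension of $(\mathcal H,\mathcal F)$ by a new vertex $v\notin S$* is a pseudohalfplane hypergraph $(\mathcal H^+,\mathcal F^+)$ on $S\cup\{v\}$, for a linear order extending that of $S$, such that $X\mapsto X\cap S$ is a bijection from the topsets of $\mathcal H^+$ onto the topsets of $\mathcal H$ and a bijection from the bottomsets of $\mathcal H^+$ onto the bottomsets of $\mathcal H$, and such that whenever the traces on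 $S$ of a topset and a bottomset of $\mathcal H^+$ are complements of each other in $S$, the two are complements of each other in $S\cup\{v\}$. Let $(\mathcal H,\mathcal F)$ be a pseudohalfplane hypergraph on $S$ and let $A,B\subseteq S$. Suppose that there is no extension of $(\mathcal H,\mathcal F)$ by a new vertex $v$ such that $v\in\mathrm{Conv}(A)\cap\mathrm{Conv}(B)$ in the extension. Then $A\cap B=\emptyset$ and there is a set $H\subseteq S$ (possibly already a hyperedge of $\mathcal H$) that separates $A$ and $B$, i.e. $A\subseteq H$ and $H\cap B=\emptyset$, or $B\subseteq H$ and $H\cap A=\emptyset$, and such that $\mathcal H\cup\{H\}$ is again a pseudohalfplane hypergraph on $S$, with an ABA-free family $\mathcal F'\supseteq\mathcal F$. -/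

import Mathlib

namespace PseudoHP

universe u

/-- A hypergraph on the ordered vertex set `S` (given by its set of hyperedges) is ABA-free if it
has no two hyperedges `A`, `B` and vertices `x < y < z` with `x, z ∈ A \ B` and `y ∈ B \ A`. -/
def ABAFree {S : Type u} [LinearOrder S] (F : Set (Set S)) : Prop :=
  ∀ A ∈ F, ∀ B ∈ F, ¬ ∃ x y z : S, x < y ∧ y < z ∧ x ∈ A \ B ∧ z ∈ A \ B ∧ y ∈ B \ A

/-- The family of the complements of the members of `F`. -/
def complFamily {S : Type u} (F : Set (Set S)) : Set (Set S) :=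
  {X | Xᶜ ∈ F}

/-- `H` is a pseudohalfplane hypergraph, with corresponding ABA-free family `F`. -/
structure IsPseudohalfplaneWith {S : Type u} [LinearOrder S] (H F : Set (Set S)) : Prop where
  abaFree : ABAFree F
  subset : H ⊆ F ∪ complFamily F

/-- The topsets of `H` with respect to the corresponding ABA-free family `F`. -/
def topsets {S : Type u} (H F : Set (Set S)) : Set (Set S) := H ∩ F

/-- The bottomsets of `H` with respect to the corresponding ABA-free family `F`. -/
def bottomsets {S : Type u} (H F : Set (Set S)) : Set (Set S) := H ∩ complFamily F

/-- The convex hull of `X` in the hypergraph `H`: the intersection of all hyperedges containing `X`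
(the whole vertex set if there is none). -/
def conv {S : Type u} (H : Set (Set S)) (X : Set S) : Set S :=
  ⋂₀ {E | E ∈ H ∧ X ⊆ E}

/-- `(H', F')` is an extension of the pseudohalfplane hypergraph `(H, F)` by the new vertex `v`.
The vertex set `S'` is `S` (embedded by `e`, keeping its order) together with the one new vertex
`v`, placed anywhere in the order. The trace on `S` is a bijection from the topsets
(resp. bottomsets) of `H'` to those of `H`, and if the traces of a topset and a bottomset of `H'`
are complements of each other in `S`, then these two are complements of each other in `S'`. -/
structure IsVertexExtension {S S' : Type u} [LinearOrder S] [LinearOrder S']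
    (H F : Set (Set S)) (e : S ↪o S') (v : S') (H' F' : Set (Set S')) : Prop where
  vertex_new : v ∉ Set.range e
  vertex_set : insert v (Set.range e) = Set.univ
  pseudohalfplane : IsPseudohalfplaneWith H' F'
  topsets_bij : Set.BijOn (fun X => e ⁻¹' X) (topsets H' F') (topsets H F)
  bottomsets_bij : Set.BijOn (fun X => e ⁻¹' X) (bottomsets H' F') (bottomsets H F)
  compl_pairs : ∀ X ∈ topsets H' F', ∀ Y ∈ bottomsets H' F', e ⁻¹' Y = (e ⁻¹' X)ᶜ → Y = Xᶜ

/-- The pseudohalfplane hypergraph `(H, F)` can be extended by a new vertex `v` such that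
`v ∈ Conv(A) ∩ Conv(B)` in the extension. -/
def ExtendableIntoHulls {S : Type u} [LinearOrder S] (H F : Set (Set S)) (A B : Set S) : Prop :=
  ∃ (S' : Type u) (_ : LinearOrder S') (e : S ↪o S') (v : S') (H' F' : Set (Set S')),
    IsVertexExtension H F e v H' F' ∧ v ∈ conv H' (e '' A) ∩ conv H' (e '' B)

/-- `X` separates the (disjoint) vertex sets `A` and `B`. -/
def Separates {S : Type u} (X A B : Set S) : Prop :=
  A ∩ B = ∅ ∧ ((A ⊆ X ∧ X ∩ B = ∅) ∨ (X ∩ A = ∅ ∧ B ⊆ X))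

end PseudoHP

/-!
The members of an ABA-free family behave like pseudolines: `s ∈ X` says that the point `s` lies
below the curve `X`. A place for a new vertex in the order of `S` is a cut, that is, a lower set
`p`. If a new vertex at `p` cannot lie in `X \ Y` without creating an ABA pattern between `X` and
`Y`, then the curve `X` is forced to run below `Y` at `p` (`Forced`). Everything rests on the
transitivity of this relation (`Forced.trans`), which has two consequences.

* A new vertex at `p` in both hulls exists as soon as no curve that contains `A` or `B` is equal
  to, or forced below, a curve that avoids `A` or `B`: put the vertex into exactly those sets that
  are equal to, or forced above, a set containing `A` or `B`
  (`extendableIntoHulls_of_not_beneath`). Hence, if there is no extension, then at every cut one of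
  `A`, `B` is `Beneath` one of `A`, `B`.
* A set which has no ABA pattern with a member of `F` on a part `T` of the vertices can be
  redefined outside `T` so as to have none at all, as an obstruction at a vertex would be a chain
  `V`, `Z`, `W` of forced relations and hence a pattern between `V` and `W`
  (`CompatOn.exists_extend`). So it suffices to show that one of `A`, `B` has no ABA pattern on `A
  ∪ B` with a member of `F`.

In an ABA pattern of `A` on `A ∪ B` the vertex in the middle lies in one of the sets `A`, `B`,
between two elements of the other. If `A` is beneath `B` at a cut next to it, the witnessing curves
would form an ABA pattern within `F` (`exists_separator_of_beneath`). So it remains to see that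
either `A` is beneath `B` at all these places or `B` is beneath `A` at all of them
(`beneath_or_beneath_of_middle`). At a cut with elements of `A` and of `B` on both sides, exactly
one of the two holds, and it is the same one for all such cuts: between consecutive cuts a forced
relation cannot be reversed (`Forced.not_flip`).
-/

namespace PseudoHP

universe u

variable {S : Type u} [LinearOrder S]

/-! ### Forced relations at a cut -/

/-- There are no `x < y < z` in `T` with `x, z ∈ X \ Y` and `y ∈ Y \ X`. The notion is not symmetric
in `X` and `Y`. -/
def AltFreeOn (T X Y : Set S) : Prop :=
  ∀ x ∈ T, ∀ y ∈ T, ∀ z ∈ T, x < y → y < z → x ∈ X \ Y → y ∈ Y \ X → z ∉ X \ Y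

theorem ABAFree.altFreeOn {F : Set (Set S)} (hF : ABAFree F) {X Y : Set S} (hX : X ∈ F)
    (hY : Y ∈ F) (T : Set S) : AltFreeOn T X Y :=
  fun x _ y _ z _ hxy hyz hx hy hz => hF X hX Y hY ⟨x, y, z, hxy, hyz, hx, hz, hy⟩

/-- At the cut `p`, a new vertex in `X \ Y` would form with two elements of `T` an ABA pattern of
`X` and `Y`. The three cases are those of the new vertex being the last, the first and the middle
one of the pattern. -/
def Forced (T : Set S) (p : LowerSet S) (X Y : Set S) : Prop :=
  (∃ x ∈ T, ∃ y ∈ T, x < y ∧ y ∈ p ∧ x ∈ X \ Y ∧ y ∈ Y \ X) ∨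
  (∃ x ∈ T, ∃ y ∈ T, x < y ∧ x ∉ p ∧ x ∈ Y \ X ∧ y ∈ X \ Y) ∨
  (∃ x ∈ T, ∃ y ∈ T, x ∈ p ∧ y ∉ p ∧ x ∈ Y \ X ∧ y ∈ Y \ X)

theorem lt_of_mem_of_notMem {p : LowerSet S} {x y : S} (hx : x ∈ p) (hy : y ∉ p) : x < y :=
  lt_of_not_ge fun h => hy (p.lower h hx)

/-- If `X` is forced below `Y` and `Y` below `Z`, then `X` is forced below `Z`. -/
theorem Forced.trans {T : Set S} {p : LowerSet S} {X Y Z : Set S}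
    (hXY : AltFreeOn T X Y) (hYX : AltFreeOn T Y X) (hYZ : AltFreeOn T Y Z)
    (hZY : AltFreeOn T Z Y)
    (h₁ : Forced T p X Y) (h₂ : Forced T p Y Z) : Forced T p X Z := by
  by_contra h
  simp only [Forced, not_or, not_exists, not_and, Set.mem_sdiff, AltFreeOn] at *
  obtain ⟨n1, n2, n3⟩ := h
  have hp : ∀ x y, x ∈ p → y ∉ p → x < y := fun x y => lt_of_mem_of_notMem
  rcases h₁ with ⟨a, ha, b, hb, h₁⟩ | ⟨a, ha, b, hb, h₁⟩ | ⟨a, ha, b, hb, h₁⟩ <;>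
  rcases h₂ with ⟨c, hc, d, hd, h₂⟩ | ⟨c, hc, d, hd, h₂⟩ | ⟨c, hc, d, hd, h₂⟩ 
  -- The later of `b`, `d` lies in `Z \ X`, and `a` or `c` is a matching earlier element of `X \ Z`.
  · obtain ⟨hab, hbp, haXY, hbYX⟩ := h₁
    obtain ⟨hcd, hdp, hcYZ, hdZY⟩ := h₂
    obtain ⟨e, he, hep, heZ, heX, hae, hce⟩ :
        ∃ e ∈ T, e ∈ p ∧ e ∈ Z ∧ e ∉ X ∧ a < e ∧ c < e := by
      rcases lt_trichotomy b d with hbd | rfl | hbd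
      · exact ⟨d, hd, hdp, hdZY.1, fun hX => hXY a ha b hb d hd hab hbd haXY hbYX hX hdZY.2,
          hab.trans hbd, hcd⟩
      · exact absurd hbYX.1 hdZY.2
      · refine ⟨b, hb, hbp, ?_, hbYX.2, hab, hcd.trans hbd⟩
        by_contra hZ
        exact hYZ c hc d hd b hb hcd hbd hcYZ hdZY hbYX.1 hZ
    grind
  · grind
  · grind
  · grind
  -- The earlier of `a`, `c` lies in `Z \ X`, and `b` or `d` is a matching later element of `X \ Z`.
  · obtain ⟨hab, hap, haYX, hbXY⟩ := h₁
    obtain ⟨hcd, hcp, hcZY, hdYZ⟩ := h₂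
    obtain ⟨e, he, hep, heZ, heX, heb, hed⟩ :
        ∃ e ∈ T, e ∉ p ∧ e ∈ Z ∧ e ∉ X ∧ e < b ∧ e < d := by
      rcases lt_trichotomy a c with hac | rfl | hac
      · refine ⟨a, ha, hap, ?_, haYX.2, hab, hac.trans hcd⟩
        by_contra hZ
        exact hYZ a ha c hc d hd hac hcd ⟨haYX.1, hZ⟩ hcZY hdYZ.1 hdYZ.2
      · exact absurd haYX.1 hcZY.2
      · exact ⟨c, hc, hcp, hcZY.1, fun hX => hXY c hc a ha b hb hac hab ⟨hX, hcZY.2⟩ haYX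
          hbXY.1 hbXY.2, hac.trans hab, hcd⟩
    grind
  · grind
  · grind
  · grind
  -- One of `a`, `c` and one of `b`, `d` lies in `Z \ X`, on either side of the cut.
  · obtain ⟨e, he, hep, heZ, heX⟩ : ∃ e ∈ T, e ∈ p ∧ e ∈ Z ∧ e ∉ X := by
      by_contra! hn
      have := hn a ha
      have := hn c hc
      have := hYX a ha c hc b hb
      have := hZY c hc a ha d hd
      grind
    obtain ⟨e', he', hep', heZ', heX'⟩ : ∃ e ∈ T, e ∉ p ∧ e ∈ Z ∧ e ∉ X := by
      by_contra! hn
      have := hn b hb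
      have := hn d hd
      have := hYX a ha d hd b hb
      have := hZY c hc b hb d hd
      grind
    exact n3 e he e' he' hep hep' ⟨heZ, heX⟩ heZ' heX'

theorem not_forced_self {T : Set S} {p : LowerSet S} {X : Set S} : ¬ Forced T p X X := by
  simp [Forced]

theorem Forced.asymm {T : Set S} {p : LowerSet S} {X Y : Set S}
    (hXY : AltFreeOn T X Y) (hYX : AltFreeOn T Y X) (h : Forced T p X Y) : ¬ Forced T p Y X := by
  intro h'
  exact not_forced_self (h.trans hXY hYX hYX hXY h')

/-- The cut `p` is immediately before or immediately after `m`; whether `m ∈ p` is left open. -/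
def Adjacent (p : LowerSet S) (m : S) : Prop := ∀ x, x ≠ m → (x ∈ p ↔ x < m)

theorem adjacent_Iic (m : S) : Adjacent (LowerSet.Iic m) m := fun x hx => by
  simp [LowerSet.mem_Iic_iff, le_iff_lt_or_eq, hx]

theorem adjacent_Iio (m : S) : Adjacent (LowerSet.Iio m) m := fun x _ => by
  simp [LowerSet.mem_Iio_iff]

theorem Adjacent.lt_of_notMem {p : LowerSet S} {m x : S} (h : Adjacent p m) (hx : x ≠ m)
    (hp : x ∉ p) : m < x := by
  have := (h x hx).not.1 hp
  exact lt_of_le_of_ne (not_lt.1 this) hx.symm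

/-- Next to the cut the forced relation is visible on `S`: a new vertex at `p` could be replaced by
`m` in the pattern that it would create. -/
theorem Forced.mem_of_mem {T : Set S} {p : LowerSet S} {X Y : Set S} {m : S}
    (h : Forced T p X Y) (hm : Adjacent p m)
    (hXY : AltFreeOn (insert m T) X Y) (hYX : AltFreeOn (insert m T) Y X) (hX : m ∈ X) :
    m ∈ Y := by
  by_contra hY
  have h1 : ∀ x, x ≠ m → x ∈ p → x < m := fun x hx => (hm x hx).1
  have h2 : ∀ x, x ≠ m → x ∉ p → m < x := fun x hx => hm.lt_of_notMem hx
  simp only [AltFreeOn, Forced, Set.mem_insert_iff, Set.mem_sdiff] at *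
  rcases h with ⟨a, ha, b, hb, h⟩ | ⟨a, ha, b, hb, h⟩ | ⟨a, ha, b, hb, h⟩
  · exact hXY a (.inr ha) b (.inr hb) m (.inl rfl) h.1 (h1 b (by grind) h.2.1) h.2.2.1 h.2.2.2
      ⟨hX, hY⟩
  · exact hXY m (.inl rfl) a (.inr ha) b (.inr hb) (h2 a (by grind) h.2.1) h.1 ⟨hX, hY⟩ h.2.2.1
      h.2.2.2
  · exact hYX a (.inr ha) m (.inl rfl) b (.inr hb) (h1 a (by grind) h.1)
      (h2 b (by grind) h.2.1) h.2.2.1 ⟨hX, hY⟩ h.2.2.2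

/-- A pattern that appears when `s` is added to `T` uses `s`, hence is a forced relation at the
cut before `s`. -/
theorem forced_of_not_altFreeOn_insert {T : Set S} {X Y : Set S} {s : S}
    (hXY : AltFreeOn T X Y) (hYX : AltFreeOn T Y X) (hY : s ∉ Y)
    (h : ¬ (AltFreeOn (insert s T) X Y ∧ AltFreeOn (insert s T) Y X)) :
    Forced T (LowerSet.Iio s) X Y := by
  by_contra hn
  apply h
  simp only [Forced, not_or, not_exists, not_and, Set.mem_sdiff, AltFreeOn, LowerSet.mem_Iio_iff,
    Set.mem_insert_iff] at *
  obtain ⟨n1, n2, n3⟩ := hn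
  constructor <;> intro x hx y hy z hz hxy hyz <;> grind

/-! ### Extending a set compatible with the family on a part of the vertices -/

theorem AltFreeOn.congr {T X Y X' : Set S} (h : ∀ x ∈ T, (x ∈ X' ↔ x ∈ X)) :
    (AltFreeOn T X' Y ↔ AltFreeOn T X Y) ∧ (AltFreeOn T Y X' ↔ AltFreeOn T Y X) := by
  simp only [AltFreeOn, Set.mem_sdiff]
  constructor <;> constructor <;> intro H x hx y hy z hz <;>
    have := H x hx y hy z hz <;> have := h x hx <;> have := h y hy <;> have := h z hz <;> tauto

theorem Forced.congr {T X Y X' Y' : Set S} {p : LowerSet S} (h : ∀ x ∈ T, (x ∈ X' ↔ x ∈ X))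
    (h' : ∀ x ∈ T, (x ∈ Y' ↔ x ∈ Y)) (hf : Forced T p X' Y') : Forced T p X Y := by
  simp only [Forced, Set.mem_sdiff] at *
  grind

/-- `Z` has no ABA pattern in `T` with a member of `F`, in either role. -/
def CompatOn (F : Set (Set S)) (T Z : Set S) : Prop :=
  ∀ W ∈ F, AltFreeOn T Z W ∧ AltFreeOn T W Z

theorem CompatOn.exists_extend_insert {F : Set (Set S)} (hF : ABAFree F) {T Z : Set S}
    (hZ : CompatOn F T Z) (s : S) :
    ∃ Z' : Set S, (∀ x ∈ T, (x ∈ Z' ↔ x ∈ Z)) ∧ CompatOn F (insert s T) Z' := by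
  by_cases hs : s ∈ T
  · exact ⟨Z, by simp, by rwa [Set.insert_eq_of_mem hs]⟩
  have e₁ : ∀ x ∈ T, (x ∈ insert s Z ↔ x ∈ Z) := by grind
  have e₂ : ∀ x ∈ T, (x ∈ Z \ {s} ↔ x ∈ Z) := by grind
  by_contra! h
  have n₁ := h _ e₁
  have n₂ := h _ e₂
  simp only [CompatOn, not_forall] at n₁ n₂
  obtain ⟨W, hW, n₁⟩ := n₁
  obtain ⟨V, hV, n₂⟩ := n₂
  have c₁ := @AltFreeOn.congr S _ T Z W _ e₁
  have c₂ := @AltFreeOn.congr S _ T Z V _ e₂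
  have hsW : s ∉ W := by
    intro hsW
    apply n₁
    have := hZ W hW
    rw [← c₁.1, ← c₁.2] at this
    simp only [AltFreeOn, Set.mem_sdiff, Set.mem_insert_iff] at *
    constructor <;> grind
  have hsV : s ∈ V := by
    by_contra hsV
    apply n₂
    have := hZ V hV
    rw [← c₂.1, ← c₂.2] at this
    simp only [AltFreeOn, Set.mem_sdiff, Set.mem_insert_iff, Set.mem_singleton_iff] at *
    constructor <;> grind
  -- `V` and `W` prevent `s ∉ Z` and `s ∈ Z`: they are forced below and above `Z`, yet `s ∈ V \ W`.
  have f₁ : Forced T (LowerSet.Iio s) Z W :=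
    (forced_of_not_altFreeOn_insert (c₁.1.2 (hZ W hW).1) (c₁.2.2 (hZ W hW).2) hsW n₁).congr e₁
      (by simp)
  have f₂ : Forced T (LowerSet.Iio s) V Z :=
    (forced_of_not_altFreeOn_insert (c₂.2.2 (hZ V hV).2) (c₂.1.2 (hZ V hV).1) (by simp)
      (by rwa [and_comm])).congr (by simp) e₂
  have f := f₂.trans (hZ V hV).2 (hZ V hV).1 (hZ W hW).1 (hZ W hW).2 f₁
  exact hsW (f.mem_of_mem (adjacent_Iio s) (hF.altFreeOn hV hW _) (hF.altFreeOn hW hV _) hsV)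

/-- The analogue of Levi's extension lemma: a partial pseudoline extends to a full one. -/
theorem CompatOn.exists_extend [Finite S] {F : Set (Set S)} (hF : ABAFree F) {T Z : Set S}
    (hZ : CompatOn F T Z) :
    ∃ Z' : Set S, (∀ x ∈ T, (x ∈ Z' ↔ x ∈ Z)) ∧ CompatOn F Set.univ Z' := by
  suffices H : ∀ D : Set S, D.Finite →
      ∃ Z' : Set S, (∀ x ∈ T, (x ∈ Z' ↔ x ∈ Z)) ∧ CompatOn F (D ∪ T) Z' by
    simpa using H Set.univ Set.finite_univ
  intro D hD
  induction D, hD using Set.Finite.induction_on with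
  | empty => exact ⟨Z, by simp, by simpa using hZ⟩
  | @insert s D _ _ ih =>
    obtain ⟨Z₁, e₁, h₁⟩ := ih
    obtain ⟨Z₂, e₂, h₂⟩ := h₁.exists_extend_insert hF s
    refine ⟨Z₂, fun x hx => (e₂ x (.inr hx)).trans (e₁ x hx), ?_⟩
    rwa [Set.insert_union]

/-! ### Inserting a vertex -/

/-- The vertices of `S` and one new vertex, placed at the cut `p` by the order below. -/
def CutExt (_p : LowerSet S) : Type u := Option S

namespace CutExt

variable {p : LowerSet S}

open Classical in
/-- The order of `CutExt p` is pulled back along `key`, whose first component tells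
whether a vertex comes before the cut, is the new one, or comes after the cut. -/
noncomputable def key : CutExt p → ℕ ×ₗ WithBot S
  | none => toLex (1, ⊥)
  | some s => toLex (if s ∈ p then 0 else 2, (s : WithBot S))

theorem key_injective : Function.Injective (key (p := p)) := by
  rintro (_ | s) (_ | t) h
  · rfl
  · simp [key] at h
  · simp [key] at h
  · have := congrArg (fun z => (ofLex z).2) h
    simp only [key, ofLex_toLex, WithBot.coe_inj] at this
    rw [this]

noncomputable instance : LinearOrder (CutExt p) := LinearOrder.lift' key key_injective

/-- A vertex of `S` as a vertex of the extension. -/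
def old (s : S) : CutExt p := some s

/-- The new vertex. -/
def new : CutExt p := none

@[simp] theorem old_ne_new (s : S) : (old s : CutExt p) ≠ new := Option.some_ne_none s

@[simp] theorem old_inj {s t : S} : (old s : CutExt p) = old t ↔ s = t :=
  Option.some_injective S |>.eq_iff

theorem cases (x : CutExt p) : x = new ∨ ∃ s, x = old s := by
  rcases x with _ | s
  · exact .inl rfl
  · exact .inr ⟨s, rfl⟩

theorem lt_iff_key {x y : CutExt p} : x < y ↔ key x < key y := Iff.rfl

theorem old_lt_old {s t : S} : (old s : CutExt p) < old t ↔ s < t := by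
  rw [lt_iff_key]
  simp only [old, key, Prod.Lex.toLex_lt_toLex]
  by_cases hs : s ∈ p <;> by_cases ht : t ∈ p
  · simp [hs, ht]
  · simp [hs, ht, lt_of_mem_of_notMem hs ht]
  · simp [hs, ht, (lt_of_mem_of_notMem ht hs).le]
  · simp [hs, ht]

theorem old_lt_new {s : S} : (old s : CutExt p) < new ↔ s ∈ p := by
  rw [lt_iff_key]
  simp only [old, new, key, Prod.Lex.toLex_lt_toLex]
  by_cases hs : s ∈ p <;> simp [hs]

theorem new_lt_old {s : S} : (new : CutExt p) < old s ↔ s ∉ p := by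
  rw [lt_iff_key]
  simp only [old, new, key, Prod.Lex.toLex_lt_toLex]
  by_cases hs : s ∈ p <;> simp [hs]

/-- The inclusion of `S` as an order embedding. -/
noncomputable def emb (p : LowerSet S) : S ↪o CutExt p :=
  OrderEmbedding.ofStrictMono old fun _ _ h => old_lt_old.2 h

@[simp] theorem emb_apply (s : S) : emb p s = old s := rfl

/-- The set `X`, together with the new vertex if `f X` holds. -/
def lift (f : Set S → Prop) (X : Set S) : Set (CutExt p) :=
  {x | (∃ s ∈ X, x = old s) ∨ (x = new ∧ f X)}

variable {f : Set S → Prop} {X Y : Set S}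

@[simp] theorem old_mem_lift {s : S} : (old s : CutExt p) ∈ lift f X ↔ s ∈ X := by
  simp [lift]

@[simp] theorem new_mem_lift : (new : CutExt p) ∈ lift f X ↔ f X := by
  simp [lift, (old_ne_new _).symm]

@[simp] theorem preimage_lift : (emb p) ⁻¹' (lift f X) = X := by
  ext s; simp

theorem abaFree_lift {F : Set (Set S)} (hF : ABAFree F)
    (hf : ∀ X ∈ F, ∀ Y ∈ F, Forced Set.univ p X Y → f X → f Y) :
    ABAFree (lift f '' F : Set (Set (CutExt p))) := by
  rintro _ ⟨X, hX, rfl⟩ _ ⟨Y, hY, rfl⟩ ⟨x, y, z, hxy, hyz, hx, hz, hy⟩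
  have h₁ := hf X hX Y hY
  have h₂ := hf Y hY X hX
  simp only [Forced, Set.mem_univ, true_and] at h₁ h₂
  rcases cases x with rfl | ⟨s, rfl⟩ <;> rcases cases y with rfl | ⟨t, rfl⟩ <;>
    rcases cases z with rfl | ⟨r, rfl⟩ <;>
    simp only [Set.mem_sdiff, old_mem_lift, new_mem_lift, old_lt_old, old_lt_new, new_lt_old,
      lt_self_iff_false] at * <;>
    try exact absurd hyz hxy
  -- The new vertex is the first, the middle, the last or no vertex of the pattern.
  · exact hx.2 (h₁ (.inr (.inl ⟨t, r, hyz, hxy, hy, hz⟩)) hx.1)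
  · exact hy.2 (h₂ (.inr (.inr ⟨s, r, hxy, hyz, hx, hz⟩)) hy.1)
  · exact hz.2 (h₁ (.inl ⟨s, t, hxy, hyz, hx, hy⟩) hz.1)
  · exact hF X hX Y hY ⟨s, t, r, hxy, hyz, hx, hz, hy⟩

/-- The extension given by a choice `f` of the sets of `F` that receive the new vertex, if `f`
respects the forced relations. Bottomsets are lifted through their complements, which keeps
complementary pairs complementary. -/
theorem isVertexExtension_lift {H F : Set (Set S)} (hH : IsPseudohalfplaneWith H F)
    (hf : ∀ X ∈ F, ∀ Y ∈ F, Forced Set.univ p X Y → f X → f Y) :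
    IsVertexExtension H F (emb p) new
      (lift f '' topsets H F ∪ {E | ∃ Y ∈ F, Yᶜ ∈ H ∧ E = (lift f Y)ᶜ}) (lift f '' F) := by
  have htop : topsets (lift f '' topsets H F ∪ {E | ∃ Y ∈ F, Yᶜ ∈ H ∧ E = (lift f Y)ᶜ})
      (lift f '' F : Set (Set (CutExt p))) = lift f '' topsets H F := by
    apply Set.Subset.antisymm
    · rintro E ⟨hE | ⟨Y, hY, hYH, rfl⟩, X, hX, hXE⟩
      · exact hE
      · have := congrArg (fun Z => (emb p) ⁻¹' Z) hXE
        simp only [Set.preimage_compl, preimage_lift] at this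
        exact ⟨X, ⟨this ▸ hYH, hX⟩, hXE⟩
    · rintro _ ⟨X, hX, rfl⟩
      exact ⟨.inl ⟨X, hX, rfl⟩, X, hX.2, rfl⟩
  have hbot : bottomsets (lift f '' topsets H F ∪ {E | ∃ Y ∈ F, Yᶜ ∈ H ∧ E = (lift f Y)ᶜ})
      (lift f '' F : Set (Set (CutExt p))) = {E | ∃ Y ∈ F, Yᶜ ∈ H ∧ E = (lift f Y)ᶜ} := by
    apply Set.Subset.antisymm
    · rintro E ⟨⟨X, hX, rfl⟩ | hE, Y, hY, hYE⟩
      · have := congrArg (fun Z => (emb p) ⁻¹' Z) hYE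
        simp only [Set.preimage_compl, preimage_lift] at this
        refine ⟨Y, hY, ?_, by rw [hYE, compl_compl]⟩
        rw [this, compl_compl]
        exact hX.1
      · exact hE
    · rintro _ ⟨Y, hY, hYH, rfl⟩
      exact ⟨.inr ⟨Y, hY, hYH, rfl⟩, Y, hY, by simp⟩
  refine ⟨?_, ?_, ⟨abaFree_lift hH.abaFree hf, ?_⟩, ?_, ?_, ?_⟩
  · rintro ⟨s, hs⟩
    exact old_ne_new s hs
  · ext x
    rcases cases x with rfl | ⟨s, rfl⟩
    · simp
    · simp only [Set.mem_univ, iff_true]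
      exact .inr ⟨s, rfl⟩
  · rintro E (⟨X, hX, rfl⟩ | ⟨Y, hY, -, rfl⟩)
    · exact .inl ⟨X, hX.2, rfl⟩
    · exact .inr ⟨Y, hY, by simp⟩
  · rw [htop]
    refine ⟨?_, ?_, ?_⟩
    · rintro _ ⟨X, hX, rfl⟩
      simpa using hX
    · rintro _ ⟨X, hX, rfl⟩ _ ⟨Y, hY, rfl⟩ h
      simp only [preimage_lift] at h
      rw [h]
    · intro X hX
      exact ⟨_, ⟨X, hX, rfl⟩, by simp⟩
  · rw [hbot]
    refine ⟨?_, ?_, ?_⟩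
    · rintro _ ⟨Y, hY, hYH, rfl⟩
      refine ⟨by simpa using hYH, ?_⟩
      simpa [complFamily] using hY
    · rintro _ ⟨X, hX, -, rfl⟩ _ ⟨Y, hY, -, rfl⟩ h
      simp only [Set.preimage_compl, preimage_lift, compl_inj_iff] at h
      rw [h]
    · intro X hX
      exact ⟨_, ⟨Xᶜ, hX.2, by simpa using hX.1, rfl⟩, by simp⟩
  · rw [htop, hbot]
    rintro _ ⟨X, hX, rfl⟩ _ ⟨Y, hY, -, rfl⟩ h
    simp only [Set.preimage_compl, preimage_lift, compl_inj_iff] at h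
    rw [h]

end CutExt

/-! ### Relative position of two sets at a cut -/

/-- At the cut `p`, the hull of `A` is below that of `B`: some member of `F` containing `A`
is equal to, or forced below, one that avoids `B`. For `A = B` this says that
the hull of `A` is empty at `p`. -/
def Beneath (F : Set (Set S)) (p : LowerSet S) (A B : Set S) : Prop :=
  ∃ X ∈ F, ∃ Y ∈ F, A ⊆ X ∧ Disjoint B Y ∧ (X = Y ∨ Forced Set.univ p X Y)

/-- If none of `A`, `B` is beneath itself or the other at the cut `p`, then a new vertex at `p` fits
into both hulls. -/
theorem extendableIntoHulls_of_not_beneath {H F : Set (Set S)} (hH : IsPseudohalfplaneWith H F)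
    {A B : Set S} {p : LowerSet S}
    (h : ∀ C ∈ ({A, B} : Set (Set S)), ∀ D ∈ ({A, B} : Set (Set S)), ¬ Beneath F p C D) :
    ExtendableIntoHulls H F A B := by
  have hF := hH.abaFree
  -- The new vertex joins the least family that contains what the hulls require and is closed under
  -- forcing; by transitivity one step of forcing suffices.
  let f : Set S → Prop := fun X =>
    ∃ C ∈ ({A, B} : Set (Set S)), ∃ W ∈ F, C ⊆ W ∧ (W = X ∨ Forced Set.univ p W X)
  have hf : ∀ X ∈ F, ∀ Y ∈ F, Forced Set.univ p X Y → f X → f Y := by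
    rintro X hX Y hY hXY ⟨C, hC, W, hW, hCW, rfl | hWX⟩
    · exact ⟨C, hC, W, hW, hCW, .inr hXY⟩
    · exact ⟨C, hC, W, hW, hCW, .inr (hWX.trans (hF.altFreeOn hW hX _) (hF.altFreeOn hX hW _)
        (hF.altFreeOn hX hY _) (hF.altFreeOn hY hX _) hXY)⟩
  refine ⟨CutExt p, inferInstance, CutExt.emb p, CutExt.new, _, _,
    CutExt.isVertexExtension_lift hH hf, ?_⟩
  have key : ∀ D ∈ ({A, B} : Set (Set S)), (CutExt.new : CutExt p) ∈
      conv (CutExt.lift f '' topsets H F ∪ {E | ∃ Y ∈ F, Yᶜ ∈ H ∧ E = (CutExt.lift f Y)ᶜ})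
        (CutExt.emb p '' D) := by
    rintro D hD E ⟨⟨X, hX, rfl⟩ | ⟨Y, hY, -, rfl⟩, hDE⟩
    · rw [CutExt.new_mem_lift]
      refine ⟨D, hD, X, hX.2, fun d hd => ?_, .inl rfl⟩
      simpa using hDE ⟨d, hd, rfl⟩
    · rw [Set.mem_compl_iff, CutExt.new_mem_lift]
      rintro ⟨C, hC, W, hW, hCW, hWY⟩
      refine h C hC D hD ⟨W, hW, Y, hY, hCW, Set.disjoint_left.2 fun d hd => ?_, hWY⟩
      simpa using hDE ⟨d, hd, rfl⟩
  exact ⟨key A (by simp), key B (by simp)⟩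

theorem Beneath.mem_imp_mem {F : Set (Set S)} (hF : ABAFree F) {p : LowerSet S} {A B : Set S}
    (h : Beneath F p A B) {m : S} (hm : Adjacent p m) :
    ∃ X ∈ F, ∃ Y ∈ F, A ⊆ X ∧ Disjoint B Y ∧ (m ∈ X → m ∈ Y) := by
  obtain ⟨X, hX, Y, hY, hA, hB, rfl | hXY⟩ := h
  · exact ⟨X, hX, X, hX, hA, hB, id⟩
  · exact ⟨X, hX, Y, hY, hA, hB,
      hXY.mem_of_mem hm (hF.altFreeOn hX hY _) (hF.altFreeOn hY hX _)⟩

theorem Beneath.notMem_inter {F : Set (Set S)} (hF : ABAFree F) {p : LowerSet S} {A B : Set S}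
    (h : Beneath F p A B) {m : S} (hm : Adjacent p m) (hA : m ∈ A) : m ∉ B := by
  obtain ⟨X, -, Y, -, hAX, hBY, hXY⟩ := h.mem_imp_mem hF hm
  exact fun hB => Set.disjoint_left.1 hBY hB (hXY (hAX hA))

/-- `A` has elements on both sides of the cut `p`. -/
def Straddles (A : Set S) (p : LowerSet S) : Prop := (∃ a ∈ A, a ∈ p) ∧ ∃ a ∈ A, a ∉ p

theorem Straddles.forced {A X Y : Set S} {p : LowerSet S} (h : Straddles A p) (hX : A ⊆ X)
    (hY : Disjoint A Y) : Forced Set.univ p Y X := by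
  obtain ⟨⟨a, ha, hap⟩, b, hb, hbp⟩ := h
  exact .inr (.inr ⟨a, trivial, b, trivial, hap, hbp, ⟨hX ha, Set.disjoint_left.1 hY ha⟩,
    hX hb, Set.disjoint_left.1 hY hb⟩)

theorem Straddles.not_beneath_self {F : Set (Set S)} (hF : ABAFree F) {A : Set S} {p : LowerSet S}
    (h : Straddles A p) : ¬ Beneath F p A A := by
  rintro ⟨X, hX, Y, hY, hAX, hAY, rfl | hXY⟩
  · exact not_forced_self (h.forced hAX hAY)
  · exact hXY.asymm (hF.altFreeOn hX hY _) (hF.altFreeOn hY hX _) (h.forced hAX hAY)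

/-- Since `B` straddles the cut, all members of `F` containing `B` are forced above those that
avoid it, so a curve witnessing that `A` is beneath `B` is below all of them. -/
theorem Beneath.exists_forced {F : Set (Set S)} (hF : ABAFree F) {A B : Set S} {p : LowerSet S}
    (h : Beneath F p A B) (hB : Straddles B p) :
    ∃ X ∈ F, A ⊆ X ∧ ∀ W ∈ F, B ⊆ W → Forced Set.univ p X W := by
  obtain ⟨X, hX, Y, hY, hAX, hBY, rfl | hXY⟩ := h
  · exact ⟨X, hX, hAX, fun W _ hBW => hB.forced hBW hBY⟩
  · exact ⟨X, hX, hAX, fun W hW hBW => hXY.trans (hF.altFreeOn hX hY _) (hF.altFreeOn hY hX _)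
      (hF.altFreeOn hY hW _) (hF.altFreeOn hW hY _)
      (hB.forced hBW hBY)⟩

/-- Between consecutive cuts, with the single vertex `s` in between, a forced relation cannot be
reversed. -/
theorem Forced.not_flip {T X Y : Set S} {p q : LowerSet S} {s : S}
    (hq : ∀ x, x ∈ q ↔ x ∈ p ∨ x = s) (hs : s ∉ p)
    (hXY : AltFreeOn T X Y) (hYX : AltFreeOn T Y X) (h : Forced T p X Y) :
    ¬ Forced T q Y X := by
  intro h'
  have hp : ∀ x y, x ∈ p → y ∉ p → x < y := fun x y => lt_of_mem_of_notMem
  have hp' : ∀ x y, x ∈ q → y ∉ q → x < y := fun x y => lt_of_mem_of_notMem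
  simp only [Forced, Set.mem_sdiff, AltFreeOn] at *
  rcases h with ⟨a, ha, b, hb, h⟩ | ⟨a, ha, b, hb, h⟩ | ⟨a, ha, b, hb, h⟩ <;>
  rcases h' with ⟨c, hc, d, hd, h'⟩ | ⟨c, hc, d, hd, h'⟩ | ⟨c, hc, d, hd, h'⟩ <;> grind

theorem Beneath.not_flip {F : Set (Set S)} (hF : ABAFree F) {A B : Set S} {p q : LowerSet S}
    (hpB : Straddles B p) (hqA : Straddles A q)
    (hpq : p = q ∨ ∃ s ∉ p, ∀ x, x ∈ q ↔ x ∈ p ∨ x = s)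
    (h : Beneath F p A B) : ¬ Beneath F q B A := by
  intro h'
  obtain ⟨X, hX, hAX, hp⟩ := h.exists_forced hF hpB
  obtain ⟨W, hW, hBW, hq⟩ := h'.exists_forced hF hqA
  have h₁ := hp W hW hBW
  have h₂ := hq X hX hAX
  obtain rfl | ⟨s, hs, hq⟩ := hpq
  · exact h₁.asymm (hF.altFreeOn hX hW _) (hF.altFreeOn hW hX _) h₂
  · exact h₁.not_flip hq hs (hF.altFreeOn hX hW _) (hF.altFreeOn hW hX _) h₂

theorem Straddles.of_between {A : Set S} {p q r : LowerSet S} (hp : Straddles A p)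
    (hq : Straddles A q) (hpr : p ≤ r) (hrq : r ≤ q) : Straddles A r := by
  obtain ⟨⟨a, ha, hap⟩, -⟩ := hp
  obtain ⟨-, b, hb, hbq⟩ := hq
  exact ⟨⟨a, ha, hpr hap⟩, b, hb, fun h => hbq (hrq h)⟩

/-- Moving the cut from `p` to `q` over one vertex at a time, the relative position of two sets
straddling both cuts cannot change. -/
theorem Beneath.not_swap_of_le [Finite S] {F : Set (Set S)} (hF : ABAFree F) {A B : Set S}
    (hAB : ∀ p, Straddles A p → Straddles B p → Beneath F p A B ∨ Beneath F p B A)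
    {p q : LowerSet S} (hpq : p ≤ q)
    (hpA : Straddles A p) (hpB : Straddles B p) (hqA : Straddles A q) (hqB : Straddles B q)
    (h : Beneath F p A B) : ¬ Beneath F q B A := by
  intro hq
  obtain rfl | hlt := hpq.eq_or_lt
  · exact h.not_flip hF hpB hqA (.inl rfl) hq
  obtain ⟨s, ⟨hsq, hsp⟩, hmin⟩ :=
    (Set.toFinite ((q : Set S) \ p)).exists_minimal (Set.sdiff_nonempty.2 hlt.not_ge)
  have hr : ∀ x, x ∈ LowerSet.Iic s ↔ x ∈ p ∨ x = s := by
    intro x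
    rw [LowerSet.mem_Iic_iff]
    constructor
    · intro hx
      by_cases hxp : x ∈ p
      · exact .inl hxp
      · exact .inr (le_antisymm hx (hmin ⟨q.lower hx hsq, hxp⟩ hx))
    · rintro (hx | rfl)
      · exact (lt_of_mem_of_notMem hx hsp).le
      · exact le_rfl
  have hpr : p ≤ LowerSet.Iic s := fun x hx => (hr x).2 (.inl hx)
  have hrq : LowerSet.Iic s ≤ q := LowerSet.Iic_le.2 hsq
  have hrA := hpA.of_between hqA hpr hrq
  have hrB := hpB.of_between hqB hpr hrq
  rcases hAB _ hrA hrB with hr' | hr'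
  · exact hr'.not_swap_of_le hF hAB hrq hrA hrB hqA hqB hq
  · exact h.not_flip hF hpB hrA (.inr ⟨s, hsp, hr⟩) hr'
termination_by ((q : Set S) \ p).ncard
decreasing_by
  apply Set.ncard_lt_ncard _ (Set.toFinite _)
  refine ⟨fun x hx => ⟨hx.1, fun h => hx.2 (hpr h)⟩, fun h => ?_⟩
  exact (h ⟨hsq, hsp⟩).2 ((hr s).2 (.inr rfl))

theorem Beneath.not_swap [Finite S] {F : Set (Set S)} (hF : ABAFree F) {A B : Set S}
    (hAB : ∀ p, Straddles A p → Straddles B p → Beneath F p A B ∨ Beneath F p B A)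
    {p q : LowerSet S}
    (hpA : Straddles A p) (hpB : Straddles B p) (hqA : Straddles A q) (hqB : Straddles B q)
    (h : Beneath F p A B) : ¬ Beneath F q B A := by
  rcases le_total p q with hpq | hpq
  · exact h.not_swap_of_le hF hAB hpq hpA hpB hqA hqB
  · exact fun hq => hq.not_swap_of_le hF (fun r hB hA => (hAB r hA hB).symm) hpq hqB hqA hpB hpA h

/-! ### Construction of the separator -/

/-- `m` is an element of `B` between two elements of `A`. -/
def Middle (A B : Set S) (m : S) : Prop := m ∈ B ∧ ∃ a ∈ A, ∃ a' ∈ A, a < m ∧ m < a'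

theorem Middle.straddles {A B : Set S} {m : S} (h : Middle A B m) {p : LowerSet S}
    (hp : Adjacent p m) : Straddles A p := by
  obtain ⟨-, a, ha, a', ha', h₁, h₂⟩ := h
  exact ⟨⟨a, ha, (hp a h₁.ne).2 h₁⟩, a', ha', fun h => h₂.not_gt ((hp a' h₂.ne').1 h)⟩

theorem Middle.exists_straddles {A B : Set S} {m : S} (h : Middle A B m) (hB : B.Nontrivial) :
    ∃ p, Adjacent p m ∧ Straddles A p ∧ Straddles B p := by
  obtain ⟨b, hb, hbm⟩ := hB.exists_ne m
  rcases lt_or_gt_of_ne hbm with hlt | hlt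
  · refine ⟨_, adjacent_Iio m, h.straddles (adjacent_Iio m), ⟨b, hb, hlt⟩, m, h.1, ?_⟩
    simp [LowerSet.mem_Iio_iff]
  · refine ⟨_, adjacent_Iic m, h.straddles (adjacent_Iic m), ⟨m, h.1, ?_⟩, b, hb, ?_⟩
    · simp [LowerSet.mem_Iic_iff]
    · simpa [LowerSet.mem_Iic_iff] using hlt

/-- If `A` is beneath `B` next to every element of one of the sets between two elements of the other,
then `A` is compatible with `F` on `A ∪ B`, and so extends to a separator. -/
theorem exists_separator_of_beneath [Finite S] {F : Set (Set S)} (hF : ABAFree F) {A B : Set S}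
    (hAB : Disjoint A B)
    (h : ∀ m, Middle A B m ∨ Middle B A m → ∃ p, Adjacent p m ∧ Beneath F p A B) :
    ∃ Z : Set S, A ⊆ Z ∧ Disjoint Z B ∧ CompatOn F Set.univ Z := by
  have hc : CompatOn F (A ∪ B) A := by
    intro W hW
    constructor
    · rintro x - y hy z - hxy hyz hx ⟨hyW, hyA⟩ hz
      have hyB : y ∈ B := hy.resolve_left hyA
      obtain ⟨p, hp, hb⟩ := h y (.inl ⟨hyB, x, hx.1, z, hz.1, hxy, hyz⟩)
      obtain ⟨X, hX, Y, -, hAX, hBY, hXY⟩ := hb.mem_imp_mem hF hp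
      exact hF X hX W hW ⟨x, y, z, hxy, hyz, ⟨hAX hx.1, hx.2⟩, ⟨hAX hz.1, hz.2⟩, hyW,
        fun hyX => Set.disjoint_left.1 hBY hyB (hXY hyX)⟩
    · rintro x hx y - z hz hxy hyz ⟨hxW, hxA⟩ ⟨hyA, hyW⟩ ⟨hzW, hzA⟩
      have hxB : x ∈ B := hx.resolve_left hxA
      have hzB : z ∈ B := hz.resolve_left hzA
      obtain ⟨p, hp, hb⟩ := h y (.inr ⟨hyA, x, hxB, z, hzB, hxy, hyz⟩)
      obtain ⟨X, -, Y, hY, hAX, hBY, hXY⟩ := hb.mem_imp_mem hF hp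
      exact hF W hW Y hY ⟨x, y, z, hxy, hyz, ⟨hxW, Set.disjoint_left.1 hBY hxB⟩,
        ⟨hzW, Set.disjoint_left.1 hBY hzB⟩, hXY (hAX hyA), hyW⟩
  obtain ⟨Z, hZ, hZc⟩ := hc.exists_extend hF
  refine ⟨Z, fun a ha => (hZ a (.inl ha)).2 ha, Set.disjoint_left.2 fun b hbZ hbB => ?_, hZc⟩
  exact Set.disjoint_left.1 hAB ((hZ b (.inr hbB)).1 hbZ) hbB

theorem abaFree_insert {F : Set (Set S)} (hF : ABAFree F) {Z : Set S}
    (hZ : CompatOn F Set.univ Z) : ABAFree (insert Z F) := by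
  rintro X (rfl | hX) Y (rfl | hY) ⟨x, y, z, hxy, hyz, hx, hz, hy⟩
  · exact hx.2 hx.1
  · exact (hZ Y hY).1 x trivial y trivial z trivial hxy hyz hx hy hz
  · exact (hZ X hX).2 x trivial y trivial z trivial hxy hyz hx hy hz
  · exact hF X hX Y hY ⟨x, y, z, hxy, hyz, hx, hz, hy⟩

/-- The relative position of `A` and `B` is the same next to all elements of one of the sets
between two elements of the other. -/
theorem beneath_or_beneath_of_middle [Finite S] {F : Set (Set S)} (hF : ABAFree F) {A B : Set S}
    (hAB : ∀ p, Beneath F p A B ∨ Beneath F p B A ∨ Beneath F p A A ∨ Beneath F p B B) :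
    (∀ m, Middle A B m ∨ Middle B A m → ∃ p, Adjacent p m ∧ Beneath F p A B) ∨
    (∀ m, Middle A B m ∨ Middle B A m → ∃ p, Adjacent p m ∧ Beneath F p B A) := by
  by_cases hn : A.Nontrivial ∧ B.Nontrivial
  · have hd : ∀ p, Straddles A p → Straddles B p → Beneath F p A B ∨ Beneath F p B A := by
      intro p hA hB
      have := hAB p
      have := hA.not_beneath_self hF
      have := hB.not_beneath_self hF
      tauto
    have hs : ∀ m, Middle A B m ∨ Middle B A m →
        ∃ p, Adjacent p m ∧ Straddles A p ∧ Straddles B p := by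
      rintro m (hm | hm)
      · exact hm.exists_straddles hn.2
      · obtain ⟨p, hp, hB, hA⟩ := hm.exists_straddles hn.1
        exact ⟨p, hp, hA, hB⟩
    by_cases hex : ∃ p, Straddles A p ∧ Straddles B p ∧ Beneath F p A B
    · obtain ⟨p, hpA, hpB, hp⟩ := hex
      refine .inl fun m hm => ?_
      obtain ⟨q, hq, hqA, hqB⟩ := hs m hm
      exact ⟨q, hq, (hd q hqA hqB).resolve_right (hp.not_swap hF hd hpA hpB hqA hqB)⟩
    · refine .inr fun m hm => ?_
      obtain ⟨q, hq, hqA, hqB⟩ := hs m hm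
      exact ⟨q, hq, (hd q hqA hqB).resolve_left fun h => hex ⟨q, hqA, hqB, h⟩⟩
  -- If one of the sets has at most one element, there is at most one such place.
  · have hu : ∀ m m', Middle A B m ∨ Middle B A m → Middle A B m' ∨ Middle B A m' → m = m' := by
      rw [not_and_or, Set.not_nontrivial_iff, Set.not_nontrivial_iff] at hn
      have hsub : ∀ C D : Set S, C.Subsingleton → ∀ m, ¬ Middle C D m := by
        rintro C D hC m ⟨-, a, ha, a', ha', h₁, h₂⟩
        exact (h₁.trans h₂).ne (hC ha ha')
      rintro m m' hm hm'
      rcases hn with hn | hn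
      · exact hn (hm.resolve_left (hsub _ _ hn m)).1 (hm'.resolve_left (hsub _ _ hn m')).1
      · exact hn (hm.resolve_right (hsub _ _ hn m)).1 (hm'.resolve_right (hsub _ _ hn m')).1
    by_cases hex : ∃ m, (Middle A B m ∨ Middle B A m)
    · obtain ⟨m, hm⟩ := hex
      have hp := adjacent_Iic m
      -- At a cut next to `m`, both hulls are nonempty: the set containing `m` has a copy of `m` in its
      -- hull, and the other set straddles the cut.
      have h₁ : ¬ Beneath F (LowerSet.Iic m) A A := by
        rcases hm with hm | hm
        · exact (hm.straddles hp).not_beneath_self hF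
        · exact fun h => h.notMem_inter hF hp hm.1 hm.1
      have h₂ : ¬ Beneath F (LowerSet.Iic m) B B := by
        rcases hm with hm | hm
        · exact fun h => h.notMem_inter hF hp hm.1 hm.1
        · exact (hm.straddles hp).not_beneath_self hF
      rcases hAB (LowerSet.Iic m) with h | h | h | h
      · exact .inl fun m' hm' => ⟨_, hu m m' hm hm' ▸ hp, h⟩
      · exact .inr fun m' hm' => ⟨_, hu m m' hm hm' ▸ hp, h⟩
      · exact absurd h h₁
      · exact absurd h h₂
    · exact .inl fun m hm => absurd ⟨m, hm⟩ hex

end PseudoHP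

theorem theorem3p8 {S : Type*} [LinearOrder S] [Finite S] (H F : Set (Set S))
    (hH : PseudoHP.IsPseudohalfplaneWith H F) (A B : Set S)
    (hAB : ¬ PseudoHP.ExtendableIntoHulls H F A B) :
    ∃ (X : Set S) (F' : Set (Set S)), PseudoHP.Separates X A B ∧ F ⊆ F' ∧
      PseudoHP.IsPseudohalfplaneWith (insert X H) F' := by
  open PseudoHP in
  have hF := hH.abaFree
  have hc : ∀ p, Beneath F p A B ∨ Beneath F p B A ∨ Beneath F p A A ∨ Beneath F p B B := by
    intro p
    by_contra! h
    refine hAB (extendableIntoHulls_of_not_beneath hH (p := p) ?_)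
    rintro C (rfl | rfl) D (rfl | rfl) <;> tauto
  -- Next to a common element, a copy of that element would lie in both hulls.
  have hd : Disjoint A B := by
    refine Set.disjoint_left.2 fun m hA hB => ?_
    have hm := adjacent_Iic m
    rcases hc (LowerSet.Iic m) with h | h | h | h
    · exact h.notMem_inter hF hm hA hB
    · exact h.notMem_inter hF hm hB hA
    · exact h.notMem_inter hF hm hA hA
    · exact h.notMem_inter hF hm hB hB
  have hins : ∀ Z, CompatOn F Set.univ Z → IsPseudohalfplaneWith (insert Z H) (insert Z F) := by
    refine fun Z hZ => ⟨abaFree_insert hF hZ, ?_⟩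
    rintro E (rfl | hE)
    · exact .inl (.inl rfl)
    · exact (hH.subset hE).imp .inr .inr
  rcases beneath_or_beneath_of_middle hF hc with h | h
  · obtain ⟨Z, hAZ, hZB, hZ⟩ := exists_separator_of_beneath hF hd h
    exact ⟨Z, insert Z F, ⟨hd.inter_eq, .inl ⟨hAZ, hZB.inter_eq⟩⟩, Set.subset_insert _ _, hins Z hZ⟩
  · obtain ⟨Z, hBZ, hZA, hZ⟩ :=
      exists_separator_of_beneath hF hd.symm fun m hm => h m hm.symm
    exact ⟨Z, insert Z F, ⟨hd.inter_eq, .inr ⟨hZA.inter_eq, hBZ⟩⟩, Set.subset_insert _ _, hins Z hZ⟩
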